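/- Let $E$ be a separable Banach space over $\mathbb K\in\{\mathbb R,\mathbb C\}$, with dual $E^*$, and let $(E^*)_1$ be the closed unit ball of $E^*$ for the dual norm, endowed with the weak-$*$ topology. Endow the set $\mathcal F((E^*)_1)$ of all closed subsets of $(E^*)_1$ with the Vietoris topology, i.e. the topology generated by the sets $\{F : F\subseteq U\}$ and $\{F : F\cap U\neq\emptyset\}$, where $U$ ranges over the open subsets of $(E^*)_1$. Let $\mathcal G_{w*}(E^*)$ be the set of all weak-$*$ closed linear subspaces of $E^*$, endowed with the Vietoris topology, i.e. the topology induced from $\mathcal F((E^*)_1)$ by the injective map $V\mapsto V\cap (E^*)_1$. Then $\mathcal G_{w*}(E^*)$ is a Polish space, that is, a separable topological space whose topology is induced by some complete metric. -/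

import Mathlib

open TopologicalSpace

noncomputable section

/-- The closed unit ball `(E*)₁ = {ω : ‖ω‖ ≤ 1}` of the dual of `E`, as a set in the dual endowed
with its weak-* topology (the norm is the dual norm). Seen as a type, it carries the
(subspace) weak-* topology. -/
def dualUnitBall (𝕜 E : Type*) [RCLike 𝕜] [NormedAddCommGroup E] [NormedSpace 𝕜 E] :
    Set (WeakDual 𝕜 E) :=
  {ω | ‖WeakDual.toStrongDual ω‖ ≤ 1}

/-- The Vietoris topology on the space of closed subsets (the empty set included) of a topological
space `X`: it is generated by the sets `{F | F ⊆ U}` and `{F | F ∩ U ≠ ∅}`, for `U` open in `X`. -/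
@[reducible]
def closedsVietoris (X : Type*) [TopologicalSpace X] : TopologicalSpace (Closeds X) :=
  (TopologicalSpace.vietoris X).induced (fun F : Closeds X => (F : Set X))

/-- The grassmannian of the dual `E*`: the set of all weak-* closed linear subspaces of `E*`. -/
def WeakStarGrassmannian (𝕜 E : Type*) [RCLike 𝕜] [NormedAddCommGroup E] [NormedSpace 𝕜 E] :
    Type _ :=
  ClosedSubmodule 𝕜 (WeakDual 𝕜 E)

namespace WeakStarGrassmannian

variable {𝕜 E : Type*} [RCLike 𝕜] [NormedAddCommGroup E] [NormedSpace 𝕜 E]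

/-- The weak-* closed subspace `V`, as a set of functionals. -/
def carrier (V : WeakStarGrassmannian 𝕜 E) : Set (WeakDual 𝕜 E) :=
  {ω | ω ∈ (show ClosedSubmodule 𝕜 (WeakDual 𝕜 E) from V)}

/-- The closed unit ball `(V)₁ = V ∩ (E*)₁` of a weak-* closed subspace `V`, as a closed subset of
the unit ball `(E*)₁` with its weak-* topology. -/
def unitBall (V : WeakStarGrassmannian 𝕜 E) : Closeds (dualUnitBall 𝕜 E) where
  carrier := {ω | (ω : WeakDual 𝕜 E) ∈ V.carrier}
  isClosed' := (ClosedSubmodule.isClosed (R := 𝕜) (M := WeakDual 𝕜 E) V).preimage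
    continuous_subtype_val

/-- A weak-* closed subspace is determined by its closed unit ball. -/
theorem unitBall_injective :
    Function.Injective (unitBall : WeakStarGrassmannian 𝕜 E → Closeds (dualUnitBall 𝕜 E)) := by
  have key : ∀ V W : ClosedSubmodule 𝕜 (WeakDual 𝕜 E),
      unitBall (𝕜 := 𝕜) (E := E) V = unitBall (𝕜 := 𝕜) (E := E) W → ∀ ω ∈ V, ω ∈ W := by
    intro V W h ω hω
    by_cases h0 : ω = 0
    · rw [h0]; exact zero_mem W
    have hn : ‖WeakDual.toStrongDual ω‖ ≠ 0 := by simpa using h0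
    have hc : ((‖WeakDual.toStrongDual ω‖ : 𝕜)) ≠ 0 := by exact_mod_cast hn
    have hb : ((‖WeakDual.toStrongDual ω‖ : 𝕜)⁻¹) • ω ∈ dualUnitBall 𝕜 E := by
      change ‖WeakDual.toStrongDual _‖ ≤ 1
      rw [map_smul, norm_smul, norm_inv, RCLike.norm_ofReal, abs_of_nonneg (norm_nonneg _),
        inv_mul_cancel₀ hn]
    have hV : (⟨_, hb⟩ : dualUnitBall 𝕜 E) ∈ unitBall (𝕜 := 𝕜) (E := E) V :=
      V.toSubmodule.smul_mem _ hω
    rw [h] at hV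
    have := W.toSubmodule.smul_mem (‖WeakDual.toStrongDual ω‖ : 𝕜) hV
    rwa [smul_inv_smul₀ hc] at this
  intro V W h
  exact SetLike.coe_injective (A := ClosedSubmodule 𝕜 (WeakDual 𝕜 E))
    (Set.Subset.antisymm (key V W h) (key W V h.symm))

/-- The Vietoris topology on the grassmannian: the topology induced by the Vietoris topology of
the space of closed subsets of `(E*)₁`, a subspace being identified with its closed unit ball. -/
instance vietorisTopology : TopologicalSpace (WeakStarGrassmannian 𝕜 E) :=
  (closedsVietoris (dualUnitBall 𝕜 E)).induced unitBall

end WeakStarGrassmannian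

end

open Topology Filter Set Metric

/-! Encode a weak-* closed subspace V by the seminorm d_V(x) = dist(x, V_⊥), where V_⊥ ⊆ E is its
preannihilator. By Hahn–Banach, d_V(x) is the maximum of |ω x| over the unit ball of V. Hence d_V
determines V, and V ↦ d_V(x) is Vietoris continuous. Conversely, pointwise convergence of the d_V
forces Vietoris convergence of the unit balls (`isInducing_toContractiveSeminorms`), so the
grassmannian is homeomorphic to the set of all d_V with the pointwise topology.

This set lies in the space of seminorms q ≤ ‖·‖, which is compact, and metrizable since E is
separable. Completeness of E lets the property of being the distance to a closed subspace be tested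
approximately, on a dense sequence (`Seminorm.exists_norm_le_of_approx`). These are countably many
open conditions, so the set is a G_δ, hence Polish. -/

/-! ### Polish G_δ sets and Hahn–Banach for seminorms -/

/-- A countable intersection of open subsets of a Polish space is Polish. -/
theorem polishSpace_iInter_of_isOpen {X : Type*} [TopologicalSpace X] [PolishSpace X]
    {U : ℕ → Set X} (hU : ∀ n, IsOpen (U n)) : PolishSpace (⋂ n, U n : Set X) := by
  have : ∀ n, PolishSpace (U n) := fun n => (hU n).polishSpace
  -- Diagonal embedding; its image is closed, being cut out by equality of coordinates.
  let f : (⋂ n, U n : Set X) → (∀ n, U n) := fun x n => ⟨x, mem_iInter.1 x.2 n⟩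
  have hf : Continuous f :=
    continuous_pi fun n => Continuous.subtype_mk continuous_subtype_val _
  have hind : IsInducing f := by
    have h : IsInducing (fun x => ((f x 0 : U 0) : X)) := IsInducing.subtypeVal
    exact h.of_comp hf (continuous_subtype_val.comp (continuous_apply 0))
  have hinj : Function.Injective f := fun x y h =>
    Subtype.ext (congrArg (fun g => ((g 0 : U 0) : X)) h)
  have hrange : range f = {g | ∀ n, ((g n : U n) : X) = (g 0 : U 0)} := by
    ext g
    constructor
    · rintro ⟨x, rfl⟩ n
      rfl
    · intro hg
      refine ⟨⟨(g 0 : U 0), mem_iInter.2 fun n => ?_⟩, ?_⟩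
      · rw [← hg n]
        exact (g n).2
      · funext n
        exact Subtype.ext (hg n).symm
  have hclosed : IsClosed (range f) := by
    rw [hrange, show {g : ∀ n, U n | ∀ n, ((g n : U n) : X) = (g 0 : U 0)} =
      ⋂ n, {g | ((g n : U n) : X) = (g 0 : U 0)} by ext; simp]
    exact isClosed_iInter fun n => isClosed_eq
      (continuous_subtype_val.comp (continuous_apply n))
      (continuous_subtype_val.comp (continuous_apply 0))
  exact IsClosedEmbedding.polishSpace ⟨⟨hind, hinj⟩, hclosed⟩

/-- For each vector there is a linear functional dominated by a given seminorm and attaining it. -/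
theorem Seminorm.exists_dual_apply_eq {𝕜 E : Type*} [RCLike 𝕜] [AddCommGroup E] [Module 𝕜 E]
    (p : Seminorm 𝕜 E) (x : E) :
    ∃ g : Module.Dual 𝕜 E, (∀ y, ‖g y‖ ≤ p y) ∧ g x = (p x : 𝕜) := by
  by_cases hx : x = 0
  · exact ⟨0, fun y => by simp, by simp [hx]⟩
  let e := LinearEquiv.toSpanNonzeroSingleton 𝕜 E x hx
  let f : Module.Dual 𝕜 (Submodule.span 𝕜 {x}) := (p x : 𝕜) • (e.symm : _ →ₗ[𝕜] 𝕜)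
  have hfe : ∀ c : 𝕜, f (e c) = (p x : 𝕜) * c := fun c => by
    simp [f, RCLike.real_smul_eq_coe_mul]
  obtain ⟨g, hg, hgp⟩ := Module.Dual.exists_extension_of_le_seminorm _ f (p := p) (by
    intro y
    obtain ⟨c, rfl⟩ := e.surjective y
    rw [hfe, norm_mul, RCLike.norm_ofReal, abs_of_nonneg (apply_nonneg p x)]
    change _ ≤ p (c • x)
    rw [map_smul_eq_mul, mul_comm])
  refine ⟨g, hgp, ?_⟩
  have h := hg (e 1)
  have he : ((e 1 : Submodule.span 𝕜 {x}) : E) = x := one_smul 𝕜 x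
  rwa [hfe, mul_one, he] at h

/-! ### Contractive seminorms, and the distance seminorms among them -/

section NormedSpace

variable {𝕜 E : Type*} [RCLike 𝕜] [NormedAddCommGroup E] [NormedSpace 𝕜 E]

theorem Seminorm.abs_sub_le_norm {q : Seminorm 𝕜 E} (hq : ∀ x, q x ≤ ‖x‖) (x y : E) :
    |q x - q y| ≤ ‖x - y‖ :=
  (abs_sub_map_le_sub q x y).trans (hq _)

theorem Seminorm.continuous_of_le_norm {q : Seminorm 𝕜 E} (hq : ∀ x, q x ≤ ‖x‖) :
    Continuous q := by
  refine LipschitzWith.continuous (K := 1) (LipschitzWith.of_dist_le_mul fun x y => ?_)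
  rw [Real.dist_eq, dist_eq_norm, NNReal.coe_one, one_mul]
  exact q.abs_sub_le_norm hq x y

/-- In a Banach space, a seminorm `q ≤ ‖·‖` which approximately is the distance to its kernel
is the distance to its kernel. -/
theorem Seminorm.exists_norm_le_of_approx [CompleteSpace E] {q : Seminorm 𝕜 E}
    (hq : ∀ x, q x ≤ ‖x‖)
    (H : ∀ x, ∀ ε > 0, ∃ y, ‖y‖ < q x + ε ∧ q (x - y) < ε) (x : E) {ε : ℝ} (hε : 0 < ε) :
    ∃ y, ‖y‖ ≤ q x + ε ∧ q (x - y) = 0 := by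
  choose! Y hY using H
  -- The first correction costs at most q x + δ and all later ones at most 3δ together, hence ε / 4.
  set δ : ℝ := ε / 4 with hδ
  have hδp : ∀ n : ℕ, 0 < δ / 2 ^ n := fun n => by positivity
  -- Successive residuals: each step subtracts an approximate correction. They converge to a point
  -- of the kernel of q.
  let s : ℕ → E := fun n => Nat.rec x (fun n z => z - Y z (δ / 2 ^ n)) n
  have hs : ∀ n, s (n + 1) = s n - Y (s n) (δ / 2 ^ n) := fun n => rfl
  have hqs : ∀ n, q (s (n + 1)) < δ / 2 ^ n := fun n => by
    rw [hs]
    exact (hY _ _ (hδp n)).2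
  have hd : ∀ n, dist (s n) (s (n + 1)) < q (s n) + δ / 2 ^ n := fun n => by
    rw [dist_eq_norm, hs, sub_sub_cancel]
    exact (hY _ _ (hδp n)).1
  have hgeo : ∀ n, dist (s (n + 1)) (s (n + 1 + 1)) ≤ 3 * δ / 2 / 2 ^ n := fun n => by
    refine ((hd (n + 1)).trans (add_lt_add_left (hqs n) _)).le.trans (le_of_eq ?_)
    rw [pow_succ]
    field_simp
    ring
  obtain ⟨a, ha⟩ := cauchySeq_tendsto_of_complete (cauchySeq_of_le_geometric_two hgeo)
  have h0 := dist_le_of_le_geometric_two_of_tendsto₀ hgeo ha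
  have hqa : q a = 0 := by
    have h1 : Tendsto (fun n => q (s (n + 1))) atTop (𝓝 (q a)) :=
      ((q.continuous_of_le_norm hq).tendsto a).comp ha
    have h2 : Tendsto (fun n : ℕ => δ / 2 ^ n) atTop (𝓝 0) := by
      have := (tendsto_pow_atTop_nhds_zero_of_lt_one (r := (1 / 2 : ℝ)) (by norm_num)
        (by norm_num)).const_mul δ
      simpa [div_eq_mul_inv] using this
    exact le_antisymm (le_of_tendsto_of_tendsto' h1 h2 fun n => (hqs n).le) (apply_nonneg q a)
  refine ⟨x - a, ?_, by rwa [sub_sub_cancel]⟩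
  have h1 := hd 0
  have h2 := dist_triangle x (s 1) a
  have h3 : s 0 = x := rfl
  rw [h3] at h1
  rw [← dist_eq_norm]
  simp only [zero_add, pow_zero, div_one] at h0 h1
  linarith

/-- The seminorms on `E` dominated by the norm, as functions. -/
def contractiveSeminorms (𝕜 E : Type*) [RCLike 𝕜] [NormedAddCommGroup E] [NormedSpace 𝕜 E] :
    Set (E → ℝ) :=
  {f | ∃ q : Seminorm 𝕜 E, (∀ x, q x ≤ ‖x‖) ∧ ⇑q = f}

theorem isCompact_contractiveSeminorms : IsCompact (contractiveSeminorms 𝕜 E) := by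
  have hK : contractiveSeminorms 𝕜 E = {f | (∀ x, f x ∈ Icc 0 ‖x‖) ∧
      (∀ x y, f (x + y) ≤ f x + f y) ∧ ∀ (c : 𝕜) x, f (c • x) = ‖c‖ * f x} := by
    ext f
    constructor
    · rintro ⟨q, hq, rfl⟩
      exact ⟨fun x => ⟨apply_nonneg q x, hq x⟩, map_add_le_add q, map_smul_eq_mul q⟩
    · rintro ⟨h1, h2, h3⟩
      exact ⟨Seminorm.of f h2 h3, fun x => (h1 x).2, rfl⟩
  have hcl : IsClosed (contractiveSeminorms 𝕜 E) := by
    rw [hK]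
    simp only [ofPred_and, ofPred_forall]
    refine IsClosed.inter (isClosed_iInter fun x => isClosed_Icc.preimage (continuous_apply x))
      (IsClosed.inter (isClosed_iInter fun x => isClosed_iInter fun y => ?_)
        (isClosed_iInter fun c => isClosed_iInter fun x => ?_))
    · exact isClosed_le (continuous_apply _) (by fun_prop)
    · exact isClosed_eq (continuous_apply _) (continuous_const.mul (continuous_apply _))
  refine (isCompact_univ_pi fun x : E => isCompact_Icc (a := 0) (b := ‖x‖)).of_isClosed_subset
    hcl ?_
  rw [hK]
  exact fun f hf x _ => hf.1 x

/-- Contractive seminorms are continuous, so restriction to a dense sequence is injective; by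
compactness it is a closed embedding into ℕ → ℝ. -/
theorem polishSpace_contractiveSeminorms [SeparableSpace E] :
    PolishSpace (contractiveSeminorms 𝕜 E) := by
  have : CompactSpace (contractiveSeminorms 𝕜 E) :=
    isCompact_iff_compactSpace.1 isCompact_contractiveSeminorms
  let r : contractiveSeminorms 𝕜 E → ℕ → ℝ := fun f n => (f : E → ℝ) (denseSeq E n)
  have hr : Continuous r :=
    continuous_pi fun n => (continuous_apply (denseSeq E n)).comp continuous_subtype_val
  refine (hr.isClosedEmbedding ?_).polishSpace
  rintro ⟨_, p, hp, rfl⟩ ⟨_, q, hq, rfl⟩ h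
  refine Subtype.ext ((denseRange_denseSeq E).equalizer (p.continuous_of_le_norm hp)
    (q.continuous_of_le_norm hq) ?_)
  exact h

/-- The functions which are the distance to some closed subspace, approximately on a dense
sequence. -/
def approxDistSeminorms (𝕜 E : Type*) [RCLike 𝕜] [NormedAddCommGroup E] [NormedSpace 𝕜 E]
    [SeparableSpace E] : Set (contractiveSeminorms 𝕜 E) :=
  ⋂ k : ℕ, {f | ∃ y : E,
    ‖y‖ < f.1 (denseSeq E k.unpair.1) + 1 / ((k.unpair.2 : ℝ) + 1) ∧
    f.1 (denseSeq E k.unpair.1 - y) < 1 / ((k.unpair.2 : ℝ) + 1)}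

theorem polishSpace_approxDistSeminorms [SeparableSpace E] :
    PolishSpace (approxDistSeminorms 𝕜 E) := by
  have : PolishSpace (contractiveSeminorms 𝕜 E) := polishSpace_contractiveSeminorms
  refine polishSpace_iInter_of_isOpen fun k => ?_
  simp only [ofPred_exists, ofPred_and]
  have hc : ∀ x : E, Continuous fun f : contractiveSeminorms 𝕜 E => f.1 x := fun x =>
    (continuous_apply x).comp continuous_subtype_val
  exact isOpen_iUnion fun y => (isOpen_lt continuous_const ((hc _).add continuous_const)).inter
    (isOpen_lt (hc _) continuous_const)

/-- Contractive seminorms are 1-Lipschitz, so testing on a dense sequence with tolerances 1/(m+1)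
suffices. -/
theorem mem_approxDistSeminorms_iff [SeparableSpace E] {f : contractiveSeminorms 𝕜 E} :
    f ∈ approxDistSeminorms 𝕜 E ↔
      ∀ x, ∀ ε > 0, ∃ y, ‖y‖ < f.1 x + ε ∧ f.1 (x - y) < ε := by
  obtain ⟨_, q, hq, rfl⟩ := f
  simp only [approxDistSeminorms, mem_iInter, mem_ofPred_eq]
  constructor
  · intro H x ε hε
    obtain ⟨m, hm⟩ := exists_nat_one_div_lt (show 0 < ε / 3 by positivity)
    obtain ⟨n, hn⟩ := (denseRange_denseSeq E).exists_dist_lt x (show 0 < ε / 3 by positivity)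
    obtain ⟨y, hy1, hy2⟩ := H (Nat.pair n m)
    rw [Nat.unpair_pair] at hy1 hy2
    rw [dist_eq_norm] at hn
    have h1 := abs_le.1 (q.abs_sub_le_norm hq x (denseSeq E n))
    have h2 := map_add_le_add q (x - denseSeq E n) (denseSeq E n - y)
    rw [sub_add_sub_cancel] at h2
    have h3 := hq (x - denseSeq E n)
    dsimp only at hy1 hy2
    exact ⟨y, by linarith [h1.1], by linarith⟩
  · intro H k
    exact H _ _ Nat.one_div_pos_of_nat

end NormedSpace

/-! ### Duality between weak-* closed subspaces and distance seminorms -/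

namespace WeakStarGrassmannian

variable {𝕜 E : Type*} [RCLike 𝕜] [NormedAddCommGroup E] [NormedSpace 𝕜 E]

/-- The underlying linear subspace. -/
def toSubmodule (V : WeakStarGrassmannian 𝕜 E) : Submodule 𝕜 (WeakDual 𝕜 E) :=
  ClosedSubmodule.toSubmodule V

theorem isClosed_toSubmodule (V : WeakStarGrassmannian 𝕜 E) :
    IsClosed (V.toSubmodule : Set (WeakDual 𝕜 E)) :=
  ClosedSubmodule.isClosed V

theorem mem_unitBall {V : WeakStarGrassmannian 𝕜 E} {ω : dualUnitBall 𝕜 E} :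
    ω ∈ (V.unitBall : Set (dualUnitBall 𝕜 E)) ↔ (ω : WeakDual 𝕜 E) ∈ V.toSubmodule :=
  Iff.rfl

/-- The vectors of `E` annihilated by a weak-* closed subspace. -/
def preannihilator (V : WeakStarGrassmannian 𝕜 E) : Submodule 𝕜 E where
  carrier := {x | ∀ ω ∈ V.toSubmodule, ω x = 0}
  add_mem' hx hy ω hω := by rw [map_add, hx ω hω, hy ω hω, add_zero]
  zero_mem' ω _ := map_zero ω
  smul_mem' c x hx ω hω := by rw [map_smul, hx ω hω, smul_zero]

/-- Bipolar theorem: Hahn–Banach separation, where weak-* continuous functionals are evaluations at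
vectors of E. -/
theorem mem_of_forall_preannihilator (V : WeakStarGrassmannian 𝕜 E) {ω : WeakDual 𝕜 E}
    (h : ∀ x ∈ V.preannihilator, ω x = 0) : ω ∈ V.toSubmodule := by
  by_contra hω
  have : LocallyConvexSpace ℝ (WeakDual 𝕜 E) :=
    (WeakDual.withSeminorms (𝕜 := 𝕜) (E := E)).toLocallyConvexSpace
  obtain ⟨f, u, hfu, huω⟩ := RCLike.geometric_hahn_banach_closed_point (𝕜 := 𝕜)
    (V.toSubmodule.restrictScalars ℝ).convex V.isClosed_toSubmodule hω
  have hf : ∀ a ∈ V.toSubmodule, f a = 0 := by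
    intro a ha
    by_contra hfa
    -- If f a ≠ 0, some multiple of a is sent exactly to the bound u.
    have h1 := hfu (((u : 𝕜) / f a) • a) (V.toSubmodule.smul_mem _ ha)
    rw [map_smul, smul_eq_mul, div_mul_cancel₀ _ hfa, RCLike.ofReal_re] at h1
    exact lt_irrefl _ h1
  obtain ⟨x, rfl⟩ := LinearMap.dualEmbedding_surjective (topDualPairing 𝕜 E) f
  have hx : ω x = 0 := h x hf
  have h0 : RCLike.re ((0 : WeakDual 𝕜 E) x) < u := hfu 0 (zero_mem V.toSubmodule)
  have h1 : u < RCLike.re (ω x) := huω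
  rw [show (0 : WeakDual 𝕜 E) x = 0 from rfl, map_zero] at h0
  rw [hx, map_zero] at h1
  exact lt_asymm h0 h1

/-- The distance to the preannihilator, as a seminorm. -/
noncomputable def distSeminorm (V : WeakStarGrassmannian 𝕜 E) : Seminorm 𝕜 E :=
  (normSeminorm 𝕜 (E ⧸ V.preannihilator)).comp V.preannihilator.mkQ

theorem distSeminorm_apply (V : WeakStarGrassmannian 𝕜 E) (x : E) :
    V.distSeminorm x = infDist x V.preannihilator :=
  QuotientAddGroup.norm_mk (S := V.preannihilator.toAddSubgroup) x

theorem distSeminorm_le_norm (V : WeakStarGrassmannian 𝕜 E) (x : E) : V.distSeminorm x ≤ ‖x‖ :=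
  Submodule.Quotient.norm_mk_le _ x

theorem distSeminorm_eq_zero (V : WeakStarGrassmannian 𝕜 E) {x : E} (hx : x ∈ V.preannihilator) :
    V.distSeminorm x = 0 := by
  rw [distSeminorm_apply]
  exact infDist_zero_of_mem hx

theorem le_distSeminorm_iff (V : WeakStarGrassmannian 𝕜 E) {x : E} {r : ℝ} :
    r ≤ V.distSeminorm x ↔ ∀ w ∈ V.preannihilator, r ≤ ‖x - w‖ := by
  rw [distSeminorm_apply, le_infDist ⟨0, zero_mem V.preannihilator⟩]
  simp only [dist_eq_norm, SetLike.mem_coe]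

theorem norm_apply_le_distSeminorm (V : WeakStarGrassmannian 𝕜 E) {ω : dualUnitBall 𝕜 E}
    (hω : ω ∈ (V.unitBall : Set (dualUnitBall 𝕜 E))) (x : E) :
    ‖(ω : WeakDual 𝕜 E) x‖ ≤ V.distSeminorm x := by
  refine V.le_distSeminorm_iff.2 fun w hw => ?_
  have h1 : (ω : WeakDual 𝕜 E) (x - w) = (ω : WeakDual 𝕜 E) x := by
    rw [map_sub, hw _ hω, sub_zero]
  rw [← h1]
  have h2 := (WeakDual.toStrongDual (ω : WeakDual 𝕜 E)).le_of_opNorm_le ω.2 (x - w)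
  rwa [one_mul] at h2

/-- A linear functional dominated by the distance to the preannihilator belongs to the unit
ball. -/
theorem exists_mem_unitBall_of_le (V : WeakStarGrassmannian 𝕜 E) (g : Module.Dual 𝕜 E)
    (hg : ∀ x, ‖g x‖ ≤ V.distSeminorm x) :
    ∃ ω ∈ (V.unitBall : Set (dualUnitBall 𝕜 E)), ∀ x, (ω : WeakDual 𝕜 E) x = g x := by
  have hg1 : ∀ x, ‖g x‖ ≤ 1 * ‖x‖ := fun x => by
    rw [one_mul]
    exact (hg x).trans (V.distSeminorm_le_norm x)
  refine ⟨⟨StrongDual.toWeakDual (g.mkContinuous 1 hg1), ?_⟩, ?_, fun x => rfl⟩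
  · exact g.mkContinuous_norm_le zero_le_one hg1
  · refine mem_unitBall.2 (V.mem_of_forall_preannihilator fun x hx => ?_)
    have h := hg x
    rw [V.distSeminorm_eq_zero hx] at h
    exact norm_le_zero_iff.1 h

theorem exists_mem_unitBall_apply_eq (V : WeakStarGrassmannian 𝕜 E) (x : E) :
    ∃ ω ∈ (V.unitBall : Set (dualUnitBall 𝕜 E)), ‖(ω : WeakDual 𝕜 E) x‖ = V.distSeminorm x := by
  obtain ⟨g, hg, hgx⟩ := V.distSeminorm.exists_dual_apply_eq x
  obtain ⟨ω, hω, h⟩ := V.exists_mem_unitBall_of_le g hg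
  refine ⟨ω, hω, ?_⟩
  rw [h, hgx, RCLike.norm_ofReal, abs_of_nonneg (apply_nonneg _ _)]

/-- A weak-* closed subspace, encoded as a seminorm dominated by the norm. -/
noncomputable def toContractiveSeminorms (V : WeakStarGrassmannian 𝕜 E) : contractiveSeminorms 𝕜 E :=
  ⟨V.distSeminorm, V.distSeminorm, V.distSeminorm_le_norm, rfl⟩

theorem toContractiveSeminorms_injective :
    Function.Injective (toContractiveSeminorms : WeakStarGrassmannian 𝕜 E → _) := by
  have key : ∀ V W : WeakStarGrassmannian 𝕜 E,
      V.toContractiveSeminorms = W.toContractiveSeminorms →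
      (V.unitBall : Set (dualUnitBall 𝕜 E)) ⊆ W.unitBall := by
    intro V W h ω hω
    have h' : ⇑V.distSeminorm = W.distSeminorm := congrArg Subtype.val h
    obtain ⟨ω', hω', he⟩ := W.exists_mem_unitBall_of_le
      (WeakDual.toStrongDual (ω : WeakDual 𝕜 E)).toLinearMap fun x => by
        rw [← h']
        exact V.norm_apply_le_distSeminorm hω x
    have : ω = ω' := Subtype.ext (DFunLike.ext _ _ fun x => (he x).symm)
    rwa [this]
  exact fun V W h => unitBall_injective
    (SetLike.coe_injective (Subset.antisymm (key V W h) (key W V h.symm)))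

theorem toContractiveSeminorms_mem [SeparableSpace E] (V : WeakStarGrassmannian 𝕜 E) :
    V.toContractiveSeminorms ∈ approxDistSeminorms 𝕜 E := by
  refine mem_approxDistSeminorms_iff.2 fun x ε hε => ?_
  change ∃ y, ‖y‖ < V.distSeminorm x + ε ∧ V.distSeminorm (x - y) < ε
  by_contra! H
  -- Taking y = x - w with w in the preannihilator, no w can come within d_V(x) + ε of x.
  have h : V.distSeminorm x + ε ≤ V.distSeminorm x := by
    refine V.le_distSeminorm_iff.2 fun w hw => ?_
    by_contra! hlt
    have := H _ hlt
    rw [sub_sub_cancel, V.distSeminorm_eq_zero hw] at this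
    linarith
  linarith

/-- The weak-* closed subspace of the functionals vanishing on the kernel of a seminorm. -/
def ofSeminorm (q : Seminorm 𝕜 E) : WeakStarGrassmannian 𝕜 E where
  carrier := {ω | ∀ x, q x = 0 → ω x = 0}
  add_mem' {a b} ha hb x hx := by
    change a x + b x = 0
    rw [ha x hx, hb x hx, add_zero]
  zero_mem' x _ := rfl
  smul_mem' c a ha x hx := by
    change c • a x = 0
    rw [ha x hx, smul_zero]
  isClosed' := by
    change IsClosed {ω : WeakDual 𝕜 E | ∀ x, q x = 0 → ω x = 0}
    simp only [ofPred_forall]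
    exact isClosed_iInter fun x => isClosed_iInter fun _ =>
      isClosed_eq (WeakDual.eval_continuous x) continuous_const

/-- Exact corrections, available by completeness, give ≤. For ≥, a functional dominated by q and
attaining q x vanishes on the kernel of q, so it kills the preannihilator. -/
theorem distSeminorm_ofSeminorm [CompleteSpace E] {q : Seminorm 𝕜 E} (hq : ∀ x, q x ≤ ‖x‖)
    (H : ∀ x, ∀ ε > 0, ∃ y, ‖y‖ < q x + ε ∧ q (x - y) < ε) (x : E) :
    (ofSeminorm q).distSeminorm x = q x := by
  apply le_antisymm
  · refine le_of_forall_pos_le_add fun ε hε => ?_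
    obtain ⟨y, hy, hqy⟩ := q.exists_norm_le_of_approx hq H x hε
    refine le_trans ?_ hy
    have h := ((ofSeminorm q).le_distSeminorm_iff (x := x)).1 le_rfl (x - y) fun ω hω => hω _ hqy
    rwa [sub_sub_cancel] at h
  · refine (ofSeminorm q).le_distSeminorm_iff.2 fun w hw => ?_
    obtain ⟨g, hg, hgx⟩ := q.exists_dual_apply_eq x
    have hg1 : ∀ x, ‖g x‖ ≤ 1 * ‖x‖ := fun x => by
      rw [one_mul]
      exact (hg x).trans (hq x)
    have hgw : g w = 0 := hw (StrongDual.toWeakDual (g.mkContinuous 1 hg1)) fun z hz => by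
      have h := hg z
      rw [hz] at h
      exact norm_le_zero_iff.1 h
    have h := hg1 (x - w)
    rwa [map_sub, hgw, sub_zero, hgx, RCLike.norm_ofReal, abs_of_nonneg (apply_nonneg q x),
      one_mul] at h

theorem exists_toContractiveSeminorms_eq [CompleteSpace E] [SeparableSpace E]
    {f : contractiveSeminorms 𝕜 E} (hf : f ∈ approxDistSeminorms 𝕜 E) :
    ∃ V : WeakStarGrassmannian 𝕜 E, V.toContractiveSeminorms = f := by
  rw [mem_approxDistSeminorms_iff] at hf
  obtain ⟨_, q, hq, rfl⟩ := f
  exact ⟨ofSeminorm q, Subtype.ext (funext (distSeminorm_ofSeminorm hq hf))⟩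

/-! ### Vietoris topology versus pointwise convergence of distance seminorms -/

theorem continuous_distSeminorm_apply (x : E) :
    Continuous fun V : WeakStarGrassmannian 𝕜 E => V.distSeminorm x := by
  have hc : Continuous fun ω : dualUnitBall 𝕜 E => ‖(ω : WeakDual 𝕜 E) x‖ :=
    ((WeakDual.eval_continuous x).comp continuous_subtype_val).norm
  have hcoe : Continuous[vietorisTopology, TopologicalSpace.vietoris (dualUnitBall 𝕜 E)]
      fun V : WeakStarGrassmannian 𝕜 E => (V.unitBall : Set (dualUnitBall 𝕜 E)) :=
    continuous_iff_le_induced.2 (le_of_eq induced_compose)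
  rw [OrderTopology.continuous_iff]
  intro a
  constructor
  · convert (vietoris.isOpen_inter_nonempty_of_isOpen
      (isOpen_lt continuous_const hc : IsOpen {ω : dualUnitBall 𝕜 E | a < ‖(ω : WeakDual 𝕜 E) x‖})).preimage hcoe
      using 1
    ext V
    constructor
    · intro h
      obtain ⟨ω, hω, he⟩ := V.exists_mem_unitBall_apply_eq x
      exact ⟨ω, hω, show a < _ from he ▸ h⟩
    · rintro ⟨ω, hω, h⟩
      exact lt_of_lt_of_le h (V.norm_apply_le_distSeminorm hω x)
  · convert (IsOpen.powerset_vietoris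
      (isOpen_lt hc continuous_const : IsOpen {ω : dualUnitBall 𝕜 E | ‖(ω : WeakDual 𝕜 E) x‖ < a})).preimage hcoe
      using 1
    ext V
    constructor
    · intro h ω hω
      exact (V.norm_apply_le_distSeminorm hω x).trans_lt h
    · intro h
      obtain ⟨ω, hω, he⟩ := V.exists_mem_unitBall_apply_eq x
      exact he.symm.trans_lt (h hω)

theorem isCompact_dualUnitBall : IsCompact (dualUnitBall 𝕜 E) := by
  convert WeakDual.isCompact_closedBall (0 : StrongDual 𝕜 E) 1 using 1
  ext ω
  simp [dualUnitBall]

/-- If the distance seminorms converge pointwise, then the unit balls eventually are contained in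
each open neighbourhood of the unit ball of the limit. -/
theorem eventually_unitBall_subset {l : Filter (WeakStarGrassmannian 𝕜 E)}
    {V₀ : WeakStarGrassmannian 𝕜 E}
    (hl : ∀ x, Tendsto (fun V : WeakStarGrassmannian 𝕜 E => V.distSeminorm x) l
      (𝓝 (V₀.distSeminorm x)))
    {U : Set (dualUnitBall 𝕜 E)} (hU : IsOpen U)
    (hV : (V₀.unitBall : Set (dualUnitBall 𝕜 E)) ⊆ U) :
    ∀ᶠ V in l, (V.unitBall : Set (dualUnitBall 𝕜 E)) ⊆ U := by
  have : CompactSpace (dualUnitBall 𝕜 E) := isCompact_iff_compactSpace.1 isCompact_dualUnitBall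
  suffices h : ∀ᶠ V in l, ∀ ω ∈ Uᶜ, ω ∉ (V.unitBall : Set (dualUnitBall 𝕜 E)) by
    filter_upwards [h] with V hV ω hω
    by_contra hn
    exact hV ω hn hω
  refine hU.isClosed_compl.isCompact.induction_on
    (p := fun s => ∀ᶠ V in l, ∀ ω ∈ s, ω ∉ (V.unitBall : Set (dualUnitBall 𝕜 E))) (by simp)
    (fun s t hst ht => ht.mono fun V h ω hω => h ω (hst hω)) (fun s t hs ht => ?_) fun ω hω => ?_
  · filter_upwards [hs, ht] with V h1 h2 ω hω
    exact hω.elim (h1 ω) (h2 ω)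
  · have hω0 : (ω : WeakDual 𝕜 E) ∉ V₀.toSubmodule := fun h => hω (hV h)
    -- This x separates: d_V(x) tends to 0, while |ω' x| stays above |ω x| / 2 for ω' near ω.
    obtain ⟨x, hx, hωx⟩ : ∃ x ∈ V₀.preannihilator, (ω : WeakDual 𝕜 E) x ≠ 0 := by
      by_contra! h
      exact hω0 (V₀.mem_of_forall_preannihilator h)
    have hpos : 0 < ‖(ω : WeakDual 𝕜 E) x‖ := norm_pos_iff.2 hωx
    have hc : Continuous fun ω : dualUnitBall 𝕜 E => ‖(ω : WeakDual 𝕜 E) x‖ :=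
      ((WeakDual.eval_continuous x).comp continuous_subtype_val).norm
    refine ⟨_, mem_nhdsWithin_of_mem_nhds
      ((isOpen_lt continuous_const hc).mem_nhds (half_lt_self hpos)), ?_⟩
    have hx0 := hl x
    rw [V₀.distSeminorm_eq_zero hx] at hx0
    filter_upwards [hx0.eventually_lt_const (half_pos hpos)] with V hV' ω' hω' hmem
    exact lt_asymm (hω'.trans_le (V.norm_apply_le_distSeminorm hmem x)) hV'

/-- Pointwise convergence of the distance seminorms is uniform on bounded subsets of finite
dimensional subspaces. -/
theorem eventually_distSeminorm_le_add {l : Filter (WeakStarGrassmannian 𝕜 E)}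
    {V₀ : WeakStarGrassmannian 𝕜 E}
    (hl : ∀ x, Tendsto (fun V : WeakStarGrassmannian 𝕜 E => V.distSeminorm x) l
      (𝓝 (V₀.distSeminorm x)))
    (M : Submodule 𝕜 E) [FiniteDimensional 𝕜 M] {c : ℝ} (hc : 0 < c) :
    ∀ᶠ V in l, ∀ m ∈ M, V₀.distSeminorm m ≤ V.distSeminorm m + c * ‖m‖ := by
  have hM : ProperSpace M := FiniteDimensional.proper 𝕜 M
  have hc3 : 0 < c / 3 := by positivity
  obtain ⟨t, -, ht, hcov⟩ := (isCompact_closedBall (0 : M) 1).finite_cover_balls hc3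
  have hev : ∀ᶠ V in l, ∀ y ∈ t, V₀.distSeminorm (y : E) - c / 3 < V.distSeminorm (y : E) :=
    (eventually_all_finite ht).2 fun y _ => (hl y).eventually_const_lt (sub_lt_self _ hc3)
  filter_upwards [hev] with V hV
  have hunit : ∀ b : M, ‖b‖ ≤ 1 → V₀.distSeminorm (b : E) ≤ V.distSeminorm (b : E) + c := by
    intro b hb
    obtain ⟨y, hy, hby⟩ := mem_iUnion₂.1 (hcov (mem_closedBall_zero_iff.2 hb))
    rw [mem_ball, dist_eq_norm] at hby
    have h1 := (abs_le.1 (V₀.distSeminorm.abs_sub_le_norm V₀.distSeminorm_le_norm b y)).2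
    have h2 := (abs_le.1 (V.distSeminorm.abs_sub_le_norm V.distSeminorm_le_norm b y)).1
    have h3 := hV y hy
    have h4 : ‖(b : E) - y‖ < c / 3 := hby
    linarith
  intro m hm
  by_cases hm0 : m = 0
  · simp [hm0]
  have hn : 0 < ‖m‖ := norm_pos_iff.2 hm0
  have h := hunit (((‖m‖ : 𝕜)⁻¹) • ⟨m, hm⟩) (by
    rw [norm_smul, norm_inv, RCLike.norm_ofReal, abs_of_pos hn]
    exact (inv_mul_cancel₀ hn.ne').le)
  rw [Submodule.coe_smul, map_smul_eq_mul, map_smul_eq_mul, norm_inv, RCLike.norm_ofReal,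
    abs_of_pos hn, inv_mul_le_iff₀ hn, mul_add, mul_inv_cancel_left₀ hn.ne'] at h
  linarith

/-- A functional in the unit ball of `V₀` can be approximated on a subspace `M` by functionals
in the unit ball of `V`, as soon as the distance seminorms are close to each other on `M`. -/
theorem exists_mem_unitBall_norm_sub_le {V₀ V : WeakStarGrassmannian 𝕜 E} {M : Submodule 𝕜 E}
    {c : ℝ} (hc : 0 ≤ c) (h : ∀ m ∈ M, V₀.distSeminorm m ≤ V.distSeminorm m + c * ‖m‖)
    {ω₀ : dualUnitBall 𝕜 E} (hω₀ : ω₀ ∈ (V₀.unitBall : Set (dualUnitBall 𝕜 E))) :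
    ∃ ω ∈ (V.unitBall : Set (dualUnitBall 𝕜 E)), ∀ m ∈ M,
      ‖(ω : WeakDual 𝕜 E) m - (ω₀ : WeakDual 𝕜 E) m‖ ≤ c * ‖m‖ := by
  -- Extending ω₀ from the diagonal of M under p splits it on M as g(·, 0) + g(0, ·): the first is
  -- dominated by d_V, the second by c‖·‖.
  let p : Seminorm 𝕜 (E × E) := V.distSeminorm.comp (LinearMap.fst 𝕜 E E) +
    (c.toNNReal) • (normSeminorm 𝕜 E).comp (LinearMap.snd 𝕜 E E)
  have hp : ∀ x y, p (x, y) = V.distSeminorm x + c * ‖y‖ := fun x y => by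
    change V.distSeminorm x + (c.toNNReal : ℝ) * ‖y‖ = _
    rw [Real.coe_toNNReal c hc]
  let S : Submodule 𝕜 (E × E) := M.map (LinearMap.prod LinearMap.id LinearMap.id)
  let φ : Module.Dual 𝕜 E := (WeakDual.toStrongDual (ω₀ : WeakDual 𝕜 E)).toLinearMap
  let f : Module.Dual 𝕜 S := φ ∘ₗ LinearMap.fst 𝕜 E E ∘ₗ S.subtype
  obtain ⟨g, hg, hgp⟩ := Module.Dual.exists_extension_of_le_seminorm S f (p := p) (by
    rintro ⟨_, m, hm, rfl⟩
    change ‖φ m‖ ≤ p (m, m)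
    rw [hp]
    exact (V₀.norm_apply_le_distSeminorm hω₀ m).trans (h m hm))
  obtain ⟨ω, hω, hωg⟩ := V.exists_mem_unitBall_of_le (g ∘ₗ LinearMap.inl 𝕜 E E) fun x => by
    have := hgp (x, 0)
    rwa [hp, norm_zero, mul_zero, add_zero] at this
  refine ⟨ω, hω, fun m hm => ?_⟩
  have h1 : g (m, m) = φ m := hg ⟨(m, m), m, hm, rfl⟩
  have h2 : g (m, m) = g (m, 0) + g (0, m) := by
    rw [← map_add, Prod.mk_add_mk, add_zero, zero_add]
  have h3 : (ω : WeakDual 𝕜 E) m = g (m, 0) := hωg m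
  have h4 : (ω₀ : WeakDual 𝕜 E) m = g (m, 0) + g (0, m) := by rw [← h2, h1]; rfl
  rw [h3, h4, sub_add_cancel_left, norm_neg]
  have h5 := hgp (0, m)
  rwa [hp, map_zero, zero_add] at h5

theorem exists_finset_subset_of_mem_nhds {ω₀ : dualUnitBall 𝕜 E} {U : Set (dualUnitBall 𝕜 E)}
    (hU : U ∈ 𝓝 ω₀) : ∃ s : Finset E, ∃ r > 0, ∀ ω : dualUnitBall 𝕜 E,
      (∀ x ∈ s, ‖(ω : WeakDual 𝕜 E) x - (ω₀ : WeakDual 𝕜 E) x‖ < r) → ω ∈ U := by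
  rw [nhds_subtype, mem_comap] at hU
  obtain ⟨U', hU', hsub⟩ := hU
  obtain ⟨s, r, hr, hball⟩ := ((WeakDual.withSeminorms (𝕜 := 𝕜) (E := E)).mem_nhds_iff _ _).1 hU'
  refine ⟨s, r, hr, fun ω hω => hsub (hball ?_)⟩
  rw [Seminorm.mem_ball]
  refine Seminorm.finset_sup_apply_lt hr fun x hx => ?_
  exact hω x hx

/-- If the distance seminorms converge pointwise, then the unit balls eventually meet each open set
which meets the unit ball of the limit. -/
theorem eventually_unitBall_inter_nonempty {l : Filter (WeakStarGrassmannian 𝕜 E)}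
    {V₀ : WeakStarGrassmannian 𝕜 E}
    (hl : ∀ x, Tendsto (fun V : WeakStarGrassmannian 𝕜 E => V.distSeminorm x) l
      (𝓝 (V₀.distSeminorm x)))
    {U : Set (dualUnitBall 𝕜 E)} (hU : IsOpen U)
    (hV : ((V₀.unitBall : Set (dualUnitBall 𝕜 E)) ∩ U).Nonempty) :
    ∀ᶠ V in l, ((V.unitBall : Set (dualUnitBall 𝕜 E)) ∩ U).Nonempty := by
  obtain ⟨ω₀, hω₀, hω₀U⟩ := hV
  obtain ⟨s, r, hr, hs⟩ := exists_finset_subset_of_mem_nhds (hU.mem_nhds hω₀U)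
  have hN : 0 ≤ ∑ x ∈ s, ‖x‖ := Finset.sum_nonneg fun x _ => norm_nonneg x
  -- Chosen so that c‖x‖ < r for every x in s, even if the sum is zero.
  have hc : 0 < r / (1 + ∑ x ∈ s, ‖x‖) := by positivity
  have : FiniteDimensional 𝕜 (Submodule.span 𝕜 (s : Set E)) :=
    FiniteDimensional.span_finset 𝕜 s
  filter_upwards [eventually_distSeminorm_le_add hl (Submodule.span 𝕜 (s : Set E)) hc] with V h
  obtain ⟨ω, hω, hωs⟩ := exists_mem_unitBall_norm_sub_le hc.le h hω₀
  refine ⟨ω, hω, hs ω fun x hx => (hωs x (Submodule.subset_span hx)).trans_lt ?_⟩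
  have hx1 : ‖x‖ ≤ ∑ x ∈ s, ‖x‖ := Finset.single_le_sum (f := fun x => ‖x‖)
    (fun x _ => norm_nonneg x) hx
  rw [div_mul_eq_mul_div, div_lt_iff₀ (by positivity)]
  exact mul_lt_mul_of_pos_left (by linarith) hr

/-- The Vietoris topology of the grassmannian is the topology of pointwise convergence of the
distance seminorms. -/
theorem isInducing_toContractiveSeminorms :
    IsInducing (toContractiveSeminorms : WeakStarGrassmannian 𝕜 E → contractiveSeminorms 𝕜 E) := by
  refine ⟨le_antisymm (continuous_iff_le_induced.1
    (Continuous.subtype_mk (continuous_pi continuous_distSeminorm_apply) _)) ?_⟩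
  have hl : ∀ V₀ : WeakStarGrassmannian 𝕜 E, ∀ x,
      Tendsto (fun V : WeakStarGrassmannian 𝕜 E => V.distSeminorm x)
        (comap toContractiveSeminorms (𝓝 V₀.toContractiveSeminorms)) (𝓝 (V₀.distSeminorm x)) :=
    fun V₀ x => (((continuous_apply x).comp continuous_subtype_val).tendsto
      V₀.toContractiveSeminorms).comp tendsto_comap
  change _ ≤ TopologicalSpace.induced _ (TopologicalSpace.induced _ (generateFrom _))
  rw [induced_compose, induced_generateFrom_eq]
  refine le_generateFrom ?_
  rintro _ ⟨_, ⟨U, hU, rfl⟩ | ⟨U, hU, rfl⟩, rfl⟩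
  · refine (@isOpen_iff_mem_nhds _ (TopologicalSpace.induced toContractiveSeminorms inferInstance) _).2 fun V₀ hV₀ => ?_
    rw [nhds_induced]
    exact eventually_unitBall_subset (hl V₀) hU hV₀
  · refine (@isOpen_iff_mem_nhds _ (TopologicalSpace.induced toContractiveSeminorms inferInstance) _).2 fun V₀ hV₀ => ?_
    rw [nhds_induced]
    exact eventually_unitBall_inter_nonempty (hl V₀) hU hV₀

end WeakStarGrassmannian

theorem mainTheorem5 (𝕜 E : Type*) [RCLike 𝕜] [NormedAddCommGroup E] [NormedSpace 𝕜 E]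
    [CompleteSpace E] [TopologicalSpace.SeparableSpace E] :
    PolishSpace (WeakStarGrassmannian 𝕜 E) := by
  have : PolishSpace (approxDistSeminorms 𝕜 E) := polishSpace_approxDistSeminorms
  let f : WeakStarGrassmannian 𝕜 E → approxDistSeminorms 𝕜 E := fun V =>
    ⟨V.toContractiveSeminorms, V.toContractiveSeminorms_mem⟩
  have hf : IsInducing f :=
    IsInducing.subtypeVal.of_comp_iff.1 WeakStarGrassmannian.isInducing_toContractiveSeminorms
  have hbij : Function.Bijective f := by
    constructor
    · exact fun V W h => WeakStarGrassmannian.toContractiveSeminorms_injective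
        (congrArg Subtype.val h)
    · intro g
      obtain ⟨V, hV⟩ := WeakStarGrassmannian.exists_toContractiveSeminorms_eq g.2
      exact ⟨V, Subtype.ext hV⟩
  refine IsClosedEmbedding.polishSpace (f := f) ⟨⟨hf, hbij.1⟩, ?_⟩
  rw [hbij.2.range_eq]
  exact isClosed_univ
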